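/- A degree sequence is a sequence of integers $\alpha=(\alpha_1,\dots,\alpha_n)$ with $n-1\ge\alpha_1\ge\alpha_2\ge\dots\ge\alpha_n\ge 0$. A realization of $\alpha$ is a simple undirected graph on the labeled vertices $v_1,\dots,v_n$ in which $v_i$ has degree $\alpha_i$ for every $i$; $\alpha$ is graphic if it has a realization. The forced set $\mathcal F(\alpha)$ is the set of all edges (unordered pairs of distinct labeled vertices) that appear in every realization of $\alpha$. Theorem. Let $n\ge 3$ and let $\alpha=(\alpha_1,\dots,\alpha_n)$ be a graphic sequence with $\alpha_n>0$. If $$n\;\ge\;\min\left\{\frac{(\alpha_1+\alpha_n+2)^2}{4\alpha_n},\ \frac{(\alpha_1+\alpha_n)^2}{2\alpha_n}\right\},$$ then $\mathcal F(\alpha)=\emptyset$, i.e. $\alpha$ has no forced edges. -/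

import Mathlib

/-- `α = (α_1, …, α_n)` (with `α_i` stored at index `i - 1`) is a degree sequence:
`n - 1 ≥ α_1 ≥ α_2 ≥ … ≥ α_n ≥ 0`. -/
def IsDegreeSequence {n : ℕ} (α : Fin n → ℕ) : Prop :=
  Antitone α ∧ ∀ i, α i + 1 ≤ n

open Classical in
/-- The simple graph `G` on the labeled vertices `v_1, …, v_n` is a (labeled) realization of `α`:
the vertex `v_i` has degree `α_i`. -/
def IsRealization {n : ℕ} (α : Fin n → ℕ) (G : SimpleGraph (Fin n)) : Prop :=
  ∀ i, G.degree i = α i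

/-- A graphic sequence: a degree sequence that has at least one realization. -/
def IsGraphic {n : ℕ} (α : Fin n → ℕ) : Prop :=
  IsDegreeSequence α ∧ ∃ G : SimpleGraph (Fin n), IsRealization α G

/-- The forced set of `α`: the set of all edges (unordered pairs of two distinct labeled vertices)
that appear in every labeled realization of `α`. -/
def forcedSet {n : ℕ} (α : Fin n → ℕ) : Set (Sym2 (Fin n)) :=
  {e | ¬ e.IsDiag ∧ ∀ G : SimpleGraph (Fin n), IsRealization α G → e ∈ G.edgeSet}

/-! Switching moves the ends of a forced edge to vertices of larger degree, so any forced edge makes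
$v_1v_2$ forced (`forced_of_forced_of_le`). Raise the first two degrees by one. A realization of the
raised sequence could be switched to contain $v_1v_2$; deleting that edge would then realize
$\alpha$ without it. So the raised sequence has no realization (`not_realizable_of_forced`).

Yet the size bound yields every Erdős–Gallai inequality for it (`exists_realization_raised`). With
$a, b$ the extreme degrees, a violation at $r \ge \max(2, b)$ gives $bn \le r(a+b+1-r)+1 \le
(a+b+1)^2/4+1$, which the bound excludes up to a few tiny cases. -/

namespace SimpleGraph

/-! ### Degrees, edge edits and switches -/

variable {V : Type*}

/-- The degree of a vertex, as the cardinality of its neighbor set. -/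
noncomputable def ndegree (G : SimpleGraph V) (i : V) : ℕ := (G.neighborSet i).ncard

lemma degree_eq_ndegree (G : SimpleGraph V) (i : V) [Fintype (G.neighborSet i)] :
    G.degree i = G.ndegree i := by
  rw [ndegree, ← G.coe_neighborFinset i, Set.ncard_coe_finset, card_neighborFinset_eq_degree]

open Classical in
lemma ndegree_eq_sum [Fintype V] (G : SimpleGraph V) (i : V) :
    G.ndegree i = ∑ j, if G.Adj i j then 1 else 0 := by
  rw [← degree_eq_ndegree, ← card_neighborFinset_eq_degree, neighborFinset_eq_filter,
    Finset.card_filter]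

lemma even_sum_ndegree [Fintype V] (G : SimpleGraph V) : Even (∑ i, G.ndegree i) := by
  classical
  simp_rw [← degree_eq_ndegree]
  rw [G.sum_degrees_eq_twice_card_edges]
  exact even_two_mul _

lemma ndegree_mono [Finite V] {G H : SimpleGraph V} (h : G ≤ H) (i : V) :
    G.ndegree i ≤ H.ndegree i :=
  Set.ncard_le_ncard (fun _ hj => h hj) (Set.toFinite _)

lemma exists_add_edge [Finite V] [DecidableEq V] (G : SimpleGraph V) {x y : V} (hne : x ≠ y) (hxy : ¬ G.Adj x y) :
    ∃ H : SimpleGraph V,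
      (∀ p q, H.Adj p q ↔ G.Adj p q ∨ (p = x ∧ q = y) ∨ (p = y ∧ q = x)) ∧
      ∀ i, H.ndegree i = G.ndegree i + (if i = x then 1 else 0) + (if i = y then 1 else 0) := by
  classical
  have := Fintype.ofFinite V
  have hyx : ¬ G.Adj y x := fun h => hxy h.symm
  have hadj : ∀ p q, (G ⊔ edge x y).Adj p q ↔
      G.Adj p q ∨ (p = x ∧ q = y) ∨ (p = y ∧ q = x) := by
    intro p q
    rw [sup_adj, edge_adj]
    constructor
    · rintro (h | ⟨h, -⟩) <;> tauto
    · rintro (h | ⟨rfl, rfl⟩ | ⟨rfl, rfl⟩)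
      · exact Or.inl h
      · exact Or.inr ⟨Or.inl ⟨rfl, rfl⟩, hne⟩
      · exact Or.inr ⟨Or.inr ⟨rfl, rfl⟩, hne.symm⟩
  refine ⟨_, hadj, fun i => ?_⟩
  rw [ndegree_eq_sum, ndegree_eq_sum]
  trans ∑ j, ((if G.Adj i j then 1 else 0) + (if i = x then (if j = y then 1 else 0) else 0) +
      (if i = y then (if j = x then 1 else 0) else 0))
  · refine Finset.sum_congr rfl fun j _ => ?_
    simp only [hadj]
    by_cases h1 : i = x <;> by_cases h2 : j = y <;> by_cases h3 : i = y <;> by_cases h4 : j = x <;>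
      simp_all
  · rw [Finset.sum_add_distrib, Finset.sum_add_distrib]
    split_ifs <;> simp

lemma exists_remove_edge [Finite V] [DecidableEq V] (G : SimpleGraph V) {x y : V} (hxy : G.Adj x y) :
    ∃ H : SimpleGraph V,
      (∀ p q, H.Adj p q ↔ G.Adj p q ∧ ¬ (p = x ∧ q = y) ∧ ¬ (p = y ∧ q = x)) ∧
      ∀ i, H.ndegree i + (if i = x then 1 else 0) + (if i = y then 1 else 0) = G.ndegree i := by
  have hadj : ∀ p q, (G \ edge x y).Adj p q ↔
      G.Adj p q ∧ ¬ (p = x ∧ q = y) ∧ ¬ (p = y ∧ q = x) := by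
    intro p q
    rw [sdiff_adj, edge_adj]
    have : G.Adj p q → p ≠ q := fun h => h.ne
    tauto
  refine ⟨_, hadj, ?_⟩
  obtain ⟨H, hH, hd⟩ := exists_add_edge (G \ edge x y) hxy.ne (by rw [hadj]; tauto)
  have : H = G := by
    ext p q
    rw [hH, hadj]
    constructor
    · rintro (h | ⟨rfl, rfl⟩ | ⟨rfl, rfl⟩)
      exacts [h.1, hxy, hxy.symm]
    · tauto
  subst this
  exact fun i => (hd i).symm

/-- A vertex `i` of degree at least that of `r` has a neighbor that `r` lacks, provided that the
converse holds. -/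
lemma exists_adj_not_adj_of_le [Finite V] (G : SimpleGraph V) {i r v : V}
    (h : G.ndegree r ≤ G.ndegree i) (hv : G.Adj r v) (hvi : v ≠ i) (hiv : ¬ G.Adj i v) :
    ∃ u, G.Adj i u ∧ u ≠ r ∧ ¬ G.Adj r u := by
  by_contra! hc
  have hss : G.neighborSet i \ {r} ⊂ G.neighborSet r \ {i} := by
    refine (Set.ssubset_iff_of_subset ?_).2 ⟨v, ⟨hv, hvi⟩, fun hv' => hiv hv'.1⟩
    rintro y ⟨hy, hyr⟩
    exact ⟨hc y hy hyr, fun hyi => (G.ne_of_adj hy) hyi.symm⟩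
  have hlt := Set.ncard_lt_ncard hss (Set.toFinite _)
  -- If `i` and `r` are adjacent, both neighborhoods lose one element, so the comparison of degrees
  -- survives.
  by_cases hir : G.Adj i r
  · have h1 := Set.ncard_sdiff_singleton_add_one (show r ∈ G.neighborSet i from hir) (Set.toFinite _)
    have h2 := Set.ncard_sdiff_singleton_add_one (show i ∈ G.neighborSet r from hir.symm)
      (Set.toFinite _)
    unfold ndegree at h
    omega
  · rw [Set.sdiff_singleton_eq_self (show r ∉ G.neighborSet i from hir),
      Set.sdiff_singleton_eq_self (show i ∉ G.neighborSet r from fun h => hir h.symm)] at hlt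
    unfold ndegree at h
    omega

lemma exists_adj_not_adj_of_lt [Finite V] (G : SimpleGraph V) {i r : V}
    (h : G.ndegree r < G.ndegree i) : ∃ u, G.Adj i u ∧ u ≠ r ∧ ¬ G.Adj r u := by
  by_contra! hc
  have hss : G.neighborSet i \ {r} ⊆ G.neighborSet r \ {i} := by
    rintro y ⟨hy, hyr⟩
    exact ⟨hc y hy hyr, fun hyi => (G.ne_of_adj hy) hyi.symm⟩
  have hle := Set.ncard_le_ncard hss (Set.toFinite _)
  by_cases hir : G.Adj i r
  · have h1 := Set.ncard_sdiff_singleton_add_one (show r ∈ G.neighborSet i from hir) (Set.toFinite _)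
    have h2 := Set.ncard_sdiff_singleton_add_one (show i ∈ G.neighborSet r from hir.symm)
      (Set.toFinite _)
    unfold ndegree at h
    omega
  · rw [Set.sdiff_singleton_eq_self (show r ∉ G.neighborSet i from hir),
      Set.sdiff_singleton_eq_self (show i ∉ G.neighborSet r from fun h => hir h.symm)] at hle
    unfold ndegree at h
    omega

/-- The 2-switch: edges `ab`, `cd` are replaced by the non-edges `ac`, `bd`. -/
lemma exists_two_switch [Finite V] (G : SimpleGraph V) {a b c d : V} (hab : G.Adj a b)
    (hcd : G.Adj c d) (hac : ¬ G.Adj a c) (hbd : ¬ G.Adj b d) (hac' : a ≠ c) (hbd' : b ≠ d) :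
    ∃ H : SimpleGraph V, (∀ i, H.ndegree i = G.ndegree i) ∧ ¬ H.Adj a b ∧ H.Adj a c := by
  classical
  have h1 := hab.ne
  have h2 := hcd.ne
  have h3 : a ≠ d := by rintro rfl; exact hac hcd.symm
  have h4 : b ≠ c := by rintro rfl; exact hac hab
  obtain ⟨G1, a1, d1⟩ := G.exists_remove_edge hab
  obtain ⟨G2, a2, d2⟩ := G1.exists_remove_edge (x := c) (y := d) (by rw [a1]; tauto)
  obtain ⟨G3, a3, d3⟩ := G2.exists_add_edge hac' (by rw [a2, a1]; tauto)
  obtain ⟨G4, a4, d4⟩ := G3.exists_add_edge hbd' (by rw [a3, a2, a1]; tauto)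
  refine ⟨G4, fun i => ?_, ?_, ?_⟩
  · have := d1 i; have := d2 i; have := d3 i; have := d4 i
    omega
  · rw [a4, a3, a2, a1]; tauto
  · rw [a4, a3]; tauto

/-! ### The Erdős–Gallai theorem -/

section ErdosGallai

variable {n : ℕ}

lemma sum_Iic_add_sum_Ioi (r : Fin n) (f : Fin n → ℕ) :
    ∑ j ∈ Finset.Iic r, f j + ∑ j ∈ Finset.Ioi r, f j = ∑ j, f j := by
  rw [← Finset.sum_filter_add_sum_filter_not Finset.univ (· ≤ r)]
  congr 1 <;> refine Finset.sum_congr ?_ fun _ _ => rfl <;> ext <;> simp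

open Classical in
/-- The number of edges seen by an initial clique whose complement is independent. -/
lemma sum_Iic_ndegree (G : SimpleGraph (Fin n)) (r : Fin n)
    (hclique : ∀ i j, i ≤ r → j ≤ r → i ≠ j → G.Adj i j)
    (hindep : ∀ i j, r < i → r < j → ¬ G.Adj i j) :
    ∑ i ∈ Finset.Iic r, G.ndegree i =
      (r + 1) * r + ∑ k ∈ Finset.Ioi r, G.ndegree k := by
  simp_rw [ndegree_eq_sum, ← sum_Iic_add_sum_Ioi r, Finset.sum_add_distrib]
  have h0 : ∑ k ∈ Finset.Ioi r, ∑ j ∈ Finset.Ioi r, (if G.Adj k j then 1 else 0) = 0 := by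
    refine Finset.sum_eq_zero fun k hk => Finset.sum_eq_zero fun j hj => if_neg ?_
    exact hindep k j (Finset.mem_Ioi.1 hk) (Finset.mem_Ioi.1 hj)
  have h1 : ∑ i ∈ Finset.Iic r, ∑ j ∈ Finset.Iic r, (if G.Adj i j then 1 else 0) =
      ((r : ℕ) + 1) * r := by
    have : ∀ i ∈ Finset.Iic r, ∑ j ∈ Finset.Iic r, (if G.Adj i j then 1 else 0) = (r : ℕ) := by
      intro i hi
      rw [← Finset.card_filter]
      have : Finset.filter (G.Adj i) (Finset.Iic r) = (Finset.Iic r).erase i := by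
        ext j
        simp only [Finset.mem_filter, Finset.mem_erase, Finset.mem_Iic]
        constructor
        · exact fun h => ⟨h.2.ne', h.1⟩
        · exact fun h => ⟨h.2, hclique i j (Finset.mem_Iic.1 hi) h.2 h.1.symm⟩
      rw [this, Finset.card_erase_of_mem hi, Fin.card_Iic]
      rfl
    rw [Finset.sum_congr rfl this, Finset.sum_const, Fin.card_Iic, smul_eq_mul]
  rw [h0, h1, add_zero, Finset.sum_comm]
  simp_rw [G.adj_comm]

/-- The improvement step of the Tripathi–Venugopalan–West proof of the Erdős–Gallai theorem. -/
lemma exists_improvement_or_violation (β : Fin n → ℕ) (hβ : Antitone β) (heven : Even (∑ i, β i))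
    (G : SimpleGraph (Fin n)) (hle : ∀ i, G.ndegree i ≤ β i) (r : Fin n)
    (hlt : ∀ i < r, G.ndegree i = β i) (hr : G.ndegree r < β r)
    (hindep : ∀ i j, r < i → r < j → ¬ G.Adj i j) :
    (∃ H : SimpleGraph (Fin n), (∀ i, H.ndegree i ≤ β i) ∧ (∀ i < r, H.ndegree i = G.ndegree i) ∧
      G.ndegree r < H.ndegree r) ∨
    (r + 1) * r + ∑ k ∈ Finset.Ioi r, min (r + 1 : ℕ) (β k) < ∑ i ∈ Finset.Iic r, β i := by
  classical
  by_contra! ⟨hno, hEG⟩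
  -- a deficient vertex is adjacent to `r`
  have hdef : ∀ k, k ≠ r → G.ndegree k < β k → G.Adj r k := by
    intro k hk hkd
    by_contra hadj
    obtain ⟨H, -, d1⟩ := G.exists_add_edge (Ne.symm hk) hadj
    have hrk : ¬ k < r := fun h => by have := hlt k h; omega
    refine absurd (hno H (fun i => ?_) fun i hi => ?_) ?_
    · have := d1 i; have := hle i
      split_ifs at * <;> subst_vars <;> omega
    · have := d1 i
      rw [if_neg hi.ne, if_neg (by rintro rfl; exact hrk hi)] at this
      exact this
    · have := d1 r
      rw [if_pos rfl] at this
      omega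
  -- Vertices before `r` are saturated, hence of larger degree than the deficient `r`.
  have hu : ∀ i < r, ∃ u, G.Adj i u ∧ u ≠ r ∧ ¬ G.Adj r u := fun i hi =>
    G.exists_adj_not_adj_of_lt (by have := hlt i hi; have := hβ hi.le; omega)
  -- earlier vertices are adjacent to `r`
  have hearly : ∀ i < r, G.Adj r i := by
    intro i hi
    by_contra hri
    obtain ⟨u, hiu, hur, hru⟩ := hu i hi
    have hiu' := hiu.ne
    have hir := hi.ne
    have hui : ¬ u = i := hiu'.symm
    have hir' : ¬ G.Adj i r := fun h => hri h.symm
    obtain ⟨G1, a1, d1⟩ := G.exists_remove_edge hiu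
    obtain ⟨G2, a2, d2⟩ := G1.exists_add_edge (x := u) (y := r) hur
      (by rw [a1]; exact fun h => hru h.1.symm)
    obtain ⟨G3, a3, d3⟩ := G2.exists_add_edge (x := i) (y := r) hir
      (by rw [a2, a1]; tauto)
    have hd : ∀ j, G3.ndegree j = G.ndegree j + (if j = r then 2 else 0) := by
      intro j
      have := d1 j; have := d2 j; have := d3 j
      split_ifs at * <;> omega
    by_cases h2 : G.ndegree r + 2 ≤ β r
    · refine absurd (hno G3 (fun j => ?_) fun j hj => ?_) ?_
      · have := hd j; have := hle j
        split_ifs at * <;> subst_vars <;> omega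
      · rw [hd, if_neg hj.ne, add_zero]
      · rw [hd, if_pos rfl]; omega
    -- The switch raised `r` by two. If its deficiency is one, parity yields another deficient `k`,
    -- and deleting `rk` leaves a net gain of one at `r`.
    · obtain ⟨k, hkr, hk⟩ : ∃ k, k ≠ r ∧ G.ndegree k < β k := by
        by_contra! hc
        have h1 : ∑ j, β j = ∑ j, G.ndegree j + 1 := by
          have e1 : ∑ j ∈ Finset.univ.erase r, β j = ∑ j ∈ Finset.univ.erase r, G.ndegree j :=
            Finset.sum_congr rfl fun j hj =>
              le_antisymm (hc j (Finset.ne_of_mem_erase hj)) (hle j)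
          have e2 : β r + ∑ j ∈ Finset.univ.erase r, β j = ∑ j, β j :=
            Finset.add_sum_erase _ _ (Finset.mem_univ r)
          have e3 : G.ndegree r + ∑ j ∈ Finset.univ.erase r, G.ndegree j = ∑ j, G.ndegree j :=
            Finset.add_sum_erase _ _ (Finset.mem_univ r)
          omega
        have h3 := G.even_sum_ndegree
        rw [h1, Nat.even_add_one] at heven
        exact heven h3
      have hrk := hdef k hkr hk
      have hrk' : ¬ k < r := fun h => by have := hlt k h; omega
      obtain ⟨G4, a4, d4⟩ := G3.exists_remove_edge (x := r) (y := k)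
        (by rw [a3, a2, a1]; have := hi.ne; tauto)
      refine absurd (hno G4 (fun j => ?_) fun j hj => ?_) ?_
      · have := hd j; have := d4 j; have := hle j
        split_ifs at * <;> subst_vars <;> omega
      · have := d4 j
        rw [if_neg hj.ne, if_neg (by rintro rfl; exact hrk' hj), hd, if_neg hj.ne] at this
        exact this
      · have := d4 r
        rw [if_pos rfl, if_neg hkr.symm, hd, if_pos rfl] at this
        omega
  -- later vertices have the largest possible degree
  have hlate : ∀ k, r < k → min (r + 1 : ℕ) (β k) ≤ G.ndegree k := by
    intro k hk
    by_contra! hc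
    obtain ⟨hc1, hc2⟩ := lt_min_iff.1 hc
    have hrk := hdef k hk.ne' hc2
    obtain ⟨i, hi, hik⟩ : ∃ i < r, ¬ G.Adj k i := by
      by_contra! hall
      have : (Finset.Iic r : Set (Fin n)) ⊆ G.neighborSet k := by
        intro i hi
        rcases (Finset.mem_Iic.1 (Finset.mem_coe.1 hi)).lt_or_eq with h | rfl
        · exact hall i h
        · exact hrk.symm
      have := Set.ncard_le_ncard this (Set.toFinite _)
      rw [Set.ncard_coe_finset, Fin.card_Iic] at this
      unfold ndegree at hc1
      omega
    obtain ⟨u, hiu, hur, hru⟩ := hu i hi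
    have hri := hearly i hi
    have huk : u ≠ k := by rintro rfl; exact hik hiu.symm
    have hik' : i ≠ k := (hi.trans hk).ne
    -- Replacing `iu` by `ur` and `ik` raises exactly `r` and `k`.
    obtain ⟨G1, a1, d1⟩ := G.exists_remove_edge hiu
    obtain ⟨G2, a2, d2⟩ := G1.exists_add_edge (x := u) (y := r) hur
      (by rw [a1]; exact fun h => hru h.1.symm)
    obtain ⟨G3, a3, d3⟩ := G2.exists_add_edge (x := i) (y := k) hik'
      (by rw [a2, a1]; have := fun h : G.Adj i k => hik h.symm; have := hk.ne'; have := huk.symm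
          tauto)
    have hd : ∀ j, G3.ndegree j = G.ndegree j + (if j = r then 1 else 0) +
        (if j = k then 1 else 0) := by
      intro j
      have := d1 j; have := d2 j; have := d3 j
      split_ifs at * <;> omega
    refine absurd (hno G3 (fun j => ?_) fun j hj => ?_) ?_
    · have := hd j; have := hle j; have := hk.ne
      split_ifs at * <;> subst_vars <;> omega
    · rw [hd, if_neg hj.ne, if_neg (hj.trans hk).ne, add_zero, add_zero]
    · rw [hd, if_pos rfl, if_neg hk.ne]; omega
  -- the vertices up to `r` form a clique
  have hclique' : ∀ i j, i < r → j < r → i ≠ j → G.Adj i j := by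
    intro i j hi hj hij
    by_contra hadj
    obtain ⟨u, hiu, hur, hru⟩ := hu i hi
    obtain ⟨w, hjw, hwr, hrw⟩ := hu j hj
    have hri := hearly i hi
    have hrj := hearly j hj
    have huj : u ≠ j := by rintro rfl; exact hru hrj
    have hwi : w ≠ i := by rintro rfl; exact hrw hri
    -- The switch below costs `w` one degree, harmless because `w` does not precede `r`.
    have hrw' : ¬ w < r := fun h => hrw (hearly w h)
    have hir := hi.ne
    have hjr := hj.ne
    obtain ⟨G1, a1, d1⟩ := G.exists_remove_edge hiu
    obtain ⟨G2, a2, d2⟩ := G1.exists_remove_edge (x := j) (y := w)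
      (by rw [a1]; have := huj.symm; have := hij.symm; tauto)
    obtain ⟨G3, a3, d3⟩ := G2.exists_add_edge (x := i) (y := j) hij
      (by rw [a2, a1]; tauto)
    obtain ⟨G4, a4, d4⟩ := G3.exists_add_edge (x := u) (y := r) hur
      (by rw [a3, a2, a1]; have := fun h : G.Adj u r => hru h.symm
          have := hir.symm; have := hjr.symm; tauto)
    have hd : ∀ k, G4.ndegree k + (if k = w then 1 else 0) =
        G.ndegree k + (if k = r then 1 else 0) := by
      intro k
      have := d1 k; have := d2 k; have := d3 k; have := d4 k
      omega
    refine absurd (hno G4 (fun k => ?_) fun k hk => ?_) ?_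
    · have := hd k; have := hle k
      split_ifs at * <;> subst_vars <;> omega
    · have := hd k
      rw [if_neg hk.ne, if_neg (by rintro rfl; exact hrw' hk)] at this
      exact this
    · have := hd r
      rw [if_pos rfl, if_neg hwr.symm] at this
      omega
  have hclique : ∀ i j, i ≤ r → j ≤ r → i ≠ j → G.Adj i j := by
    intro i j hi hj hij
    rcases hi.lt_or_eq with hi | rfl <;> rcases hj.lt_or_eq with hj | rfl
    · exact hclique' i j hi hj hij
    · exact (hearly i hi).symm
    · exact hearly j hj
    · exact absurd rfl hij
  have h1 := G.sum_Iic_ndegree r hclique hindep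
  have h2 : ∑ i ∈ Finset.Iic r, G.ndegree i < ∑ i ∈ Finset.Iic r, β i :=
    Finset.sum_lt_sum (fun i _ => hle i) ⟨r, Finset.mem_Iic.2 le_rfl, hr⟩
  have h3 : ∑ k ∈ Finset.Ioi r, min (r + 1 : ℕ) (β k) ≤ ∑ k ∈ Finset.Ioi r, G.ndegree k :=
    Finset.sum_le_sum fun k hk => hlate k (Finset.mem_Ioi.1 hk)
  omega

/-- The Erdős–Gallai theorem: an antitone sequence with even sum is the degree sequence of a graph
unless it violates one of the Erdős–Gallai inequalities. -/
theorem exists_ndegree_eq_or_violation (β : Fin n → ℕ) (hβ : Antitone β)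
    (heven : Even (∑ i, β i)) :
    (∃ G : SimpleGraph (Fin n), ∀ i, G.ndegree i = β i) ∨
    ∃ r : Fin n, (r + 1) * r + ∑ k ∈ Finset.Ioi r, min (r + 1 : ℕ) (β k) <
      ∑ i ∈ Finset.Iic r, β i := by
  obtain ⟨G, hG, hmax⟩ := Set.exists_max_image
    {G : SimpleGraph (Fin n) | ∀ i, G.ndegree i ≤ β i} (fun G => toLex G.ndegree)
    (Set.toFinite _) ⟨⊥, fun i => by simp [ndegree]⟩
  by_cases hex : ∃ i, G.ndegree i ≠ β i
  swap
  · left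
    exact ⟨G, by simpa using hex⟩
  right
  obtain ⟨r, hr, hmin⟩ := exists_minimal_of_wellFoundedLT _ hex
  have hlt : ∀ i < r, G.ndegree i = β i := by
    intro i hi
    by_contra h
    exact absurd (hmin h hi.le) (not_le.2 hi)
  -- Edges beyond `r` can be dropped: an improvement at `r` contradicts lexicographic maximality
  -- whatever happens to later degrees.
  let G' : SimpleGraph (Fin n) :=
    { Adj := fun i j => G.Adj i j ∧ ¬ (r < i ∧ r < j)
      symm := ⟨fun i j h => ⟨h.1.symm, fun h' => h.2 h'.symm⟩⟩
      loopless := ⟨fun i h => h.1.ne rfl⟩ }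
  have hG' : G' ≤ G := fun i j h => h.1
  have hdeg : ∀ i ≤ r, G'.ndegree i = G.ndegree i := by
    intro i hi
    unfold ndegree
    congr 1
    ext j
    exact ⟨fun h => h.1, fun h => ⟨h, fun h' => absurd h'.1 (not_lt.2 hi)⟩⟩
  refine ⟨r, (exists_improvement_or_violation β hβ heven G'
    (fun i => (ndegree_mono hG' i).trans (hG i)) r (fun i hi => (hdeg i hi.le).trans (hlt i hi))
    ((hdeg r le_rfl).trans_lt (lt_of_le_of_ne (hG r) hr))
    fun i j hi hj h => h.2 ⟨hi, hj⟩).resolve_left ?_⟩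
  rintro ⟨H, hH, hH1, hH2⟩
  refine absurd (hmax H hH) (not_le.2 ?_)
  refine ⟨r, fun j hj => ?_, ?_⟩
  · exact ((hH1 j hj).trans (hdeg j hj.le)).symm
  · exact (hdeg r le_rfl).symm.trans_lt hH2

end ErdosGallai

end SimpleGraph

/-! ### Forced edges -/

/-- A realization lacking the edge `uv` can be rebuilt to lack the edge `wv`, when `w` has at least
the degree of `u`; contrapositively, forced edges move up to vertices of larger degree. -/
lemma forced_of_forced_of_le {n : ℕ} {α : Fin n → ℕ} {u v w : Fin n} (hwv : w ≠ v)
    (hle : α u ≤ α w)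
    (h : ∀ G : SimpleGraph (Fin n), (∀ i, G.ndegree i = α i) → G.Adj u v)
    (G : SimpleGraph (Fin n)) (hG : ∀ i, G.ndegree i = α i) : G.Adj w v := by
  by_contra hadj
  have huv := h G hG
  obtain ⟨y, hwy, hyu, huy⟩ := G.exists_adj_not_adj_of_le (i := w) (r := u)
    (by rw [hG, hG]; exact hle) huv hwv.symm hadj
  obtain ⟨H, hH, hH', -⟩ := G.exists_two_switch huv hwy.symm huy (fun h => hadj h.symm)
    hyu.symm hwv.symm
  exact hH' (h H fun i => (hH i).trans (hG i))

/-- If the edge between two vertices of largest degree is forced, then raising both of their degrees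
by one gives a sequence without realization. -/
lemma not_realizable_of_forced {n : ℕ} {α : Fin n → ℕ} {u v : Fin n} (huv : u ≠ v)
    (hv : ∀ i, i ≠ u → α i ≤ α v)
    (h : ∀ G : SimpleGraph (Fin n), (∀ i, G.ndegree i = α i) → G.Adj u v)
    (H : SimpleGraph (Fin n))
    (hH : ∀ i, H.ndegree i = α i + (if i = u then 1 else 0) + (if i = v then 1 else 0)) :
    False := by
  -- removing `uv` from a realization that contains it contradicts forcedness
  have hno : ∀ K : SimpleGraph (Fin n), (∀ i, K.ndegree i = H.ndegree i) → ¬ K.Adj u v := by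
    intro K hK hadj
    obtain ⟨L, aL, dL⟩ := K.exists_remove_edge hadj
    have := h L fun i => by
      have := dL i; have := hK i; have := hH i
      omega
    rw [aL] at this
    exact this.2.1 ⟨rfl, rfl⟩
  have hHuv := hno H fun _ => rfl
  obtain ⟨x, hx⟩ : (H.neighborSet u).Nonempty := by
    refine Set.nonempty_of_ncard_ne_zero ?_
    have := hH u
    rw [if_pos rfl] at this
    unfold SimpleGraph.ndegree at this
    omega
  have hxu : x ≠ u := (H.ne_of_adj hx).symm
  have hxv : x ≠ v := by rintro rfl; exact hHuv hx
  -- Here `u` is a neighbor of `x` but not of `v`. Switching `ux`, `vy` to `uv`, `xy` then creates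
  -- `uv`.
  obtain ⟨y, hvy, hyx, hxy⟩ := H.exists_adj_not_adj_of_le (i := v) (r := x) (v := u)
    (by rw [hH, hH, if_neg hxu, if_neg hxv, if_pos rfl]; have := hv x hxu; omega)
    hx.symm huv (fun h => hHuv h.symm)
  obtain ⟨K, hK, -, hK'⟩ := H.exists_two_switch hx hvy hHuv hxy huv hyx.symm
  exact hno K hK hK'

/-! ### Arithmetic of the size bound -/

lemma max_lt_of_bound {n a b : ℕ} (hb : 0 < b) (hba : b ≤ a) (hn : 3 ≤ n)
    (h : (a + b + 2) ^ 2 ≤ 4 * b * n ∨ (a + b) ^ 2 ≤ 2 * b * n) : a + 2 ≤ n := by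
  by_contra! hc
  -- The first bound contradicts $(a+b+2)^2 \ge 4(a+1)(b+1)$; the second leaves only $a = b = 1$,
  -- excluded by $n \ge 3$.
  rcases h with h | h
  · have h1 : 4 * b * n ≤ 4 * b * (a + 1) := Nat.mul_le_mul_left _ (by omega)
    zify at *
    nlinarith [sq_nonneg ((a : ℤ) + 1 - b)]
  · have h1 : 2 * b * n ≤ 2 * b * (a + 1) := Nat.mul_le_mul_left _ (by omega)
    have h2 : a * a + b * b ≤ 2 * b := by nlinarith
    have h3 : b * b ≤ a * a := Nat.mul_le_mul hba hba
    have h4 : b = 1 := by nlinarith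
    subst h4
    have h5 : a < 2 := by nlinarith
    omega

/-- The arithmetic core: the size bound excludes a violated Erdős–Gallai inequality at an index
`r ≥ 2`, small parameters apart. -/
lemma bound_arith {n a b r : ℕ} (hb : 0 < b) (hba : b ≤ a) (hn : 3 ≤ n)
    (h : (a + b + 2) ^ 2 ≤ 4 * b * n ∨ (a + b) ^ 2 ≤ 2 * b * n) (hr : 2 ≤ r) (hrn : r ≤ n)
    (hs : 4 ≤ a + b ∨ 3 ≤ r)
    (hEG : r * (r - 1) + (n - r) * min r b ≤ r * a + 1) : False := by
  have han := max_lt_of_bound hb hba hn h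
  obtain ⟨m, rfl⟩ := Nat.exists_eq_add_of_le hrn
  obtain ⟨s, rfl⟩ := Nat.exists_eq_add_of_le hr
  rw [Nat.add_sub_cancel_left, show 2 + s - 1 = s + 1 by omega] at hEG
  rcases le_total (2 + s) b with hrb | hrb
  -- With $r$ for `2 + s`, this reads $r(n-1) \le ra+1$, so $n-1 \le a$ as $r \ge 2$.
  · rw [min_eq_left hrb] at hEG
    nlinarith
  · rw [min_eq_right hrb] at hEG
    have key : 4 * b * (2 + s + m) ≤ (a + b + 1) ^ 2 + 4 := by
      zify at *
      nlinarith [sq_nonneg ((a : ℤ) + b + 1 - 2 * (2 + s))]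
    rcases h with h | h
    · nlinarith
    -- The second bound refutes `key` only when $a+b \ge 4$; otherwise `hEG` is used directly with
    -- $r \ge 3$.
    · by_cases h4 : 4 ≤ a + b
      · nlinarith
      · have hb1 : b = 1 := by omega
        have hs1 : 1 ≤ s := by omega
        subst hb1
        obtain rfl | rfl : a = 1 ∨ a = 2 := by omega
        · nlinarith
        · nlinarith

lemma nat_bound_of_real_bound {n a b : ℕ} (hb : 0 < b)
    (h : (n : ℝ) ≥ min (((a : ℝ) + b + 2) ^ 2 / (4 * b)) (((a : ℝ) + b) ^ 2 / (2 * b))) :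
    (a + b + 2) ^ 2 ≤ 4 * b * n ∨ (a + b) ^ 2 ≤ 2 * b * n := by
  have hb' : (0 : ℝ) < b := by exact_mod_cast hb
  refine (min_le_iff.1 h).imp (fun h => ?_) fun h => ?_ <;>
    rw [div_le_iff₀ (by positivity), mul_comm] at h <;> exact_mod_cast h

/-! ### The raised sequence and the main theorem -/

/-- Raising the first two entries by one gives a realizable sequence under the size bound. -/
lemma exists_realization_raised {n : ℕ} {α : Fin n → ℕ} (hα : Antitone α)
    (heven : Even (∑ i, α i)) {u v : Fin n} (hu : (u : ℕ) = 0) (hv : (v : ℕ) = 1)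
    {b : ℕ} (hb : 0 < b) (hbα : ∀ i, b ≤ α i) (hn : 3 ≤ n)
    (h : (α u + b + 2) ^ 2 ≤ 4 * b * n ∨ (α u + b) ^ 2 ≤ 2 * b * n) :
    ∃ H : SimpleGraph (Fin n), ∀ i,
      H.ndegree i = α i + (if i = u then 1 else 0) + (if i = v then 1 else 0) := by
  set β : Fin n → ℕ := fun i => α i + (if i = u then 1 else 0) + (if i = v then 1 else 0) with hβ
  have hαu : ∀ i, α i ≤ α u := fun i => hα (Fin.le_def.2 (by omega))
  have hanti : Antitone β := by
    intro i j hij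
    have h1 := hα hij
    have h2 := Fin.le_def.1 hij
    simp only [hβ, Fin.ext_iff, hu, hv]
    split_ifs <;> omega
  have hsum : ∑ i, β i = ∑ i, α i + 2 := by
    simp [hβ, Finset.sum_add_distrib]
  have heven' : Even (∑ i, β i) := by
    rw [hsum]
    exact heven.add even_two
  refine (SimpleGraph.exists_ndegree_eq_or_violation β hanti heven').resolve_right ?_
  rintro ⟨r, hr⟩
  have han := max_lt_of_bound hb (hbα u) hn h
  have hlow : (n - (r + 1)) * min (r + 1 : ℕ) b ≤ ∑ k ∈ Finset.Ioi r, min (r + 1 : ℕ) (β k) := by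
    have : ∀ k ∈ Finset.Ioi r, min (r + 1 : ℕ) b ≤ min (r + 1 : ℕ) (β k) := fun k _ =>
      min_le_min_left _ ((hbα k).trans (by simp only [hβ]; omega))
    have := Finset.card_nsmul_le_sum _ _ _ this
    rwa [Fin.card_Ioi, smul_eq_mul, show n - 1 - (r : ℕ) = n - (r + 1) by omega] at this
  have hupα : ∑ i ∈ Finset.Iic r, α i ≤ (r + 1) * α u := by
    have := Finset.sum_le_card_nsmul (Finset.Iic r) α (α u) fun i _ => hαu i
    rwa [Fin.card_Iic, smul_eq_mul] at this
  have hup : ∑ i ∈ Finset.Iic r, β i =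
      ∑ i ∈ Finset.Iic r, α i + (if (0 : ℕ) ≤ r then 1 else 0) + (if 1 ≤ (r : ℕ) then 1 else 0) := by
    simp [hβ, Finset.sum_add_distrib, Fin.le_def, hu, hv]
  rw [if_pos (Nat.zero_le _)] at hup
  rcases Nat.eq_zero_or_pos (r : ℕ) with h0 | h0
  · rw [if_neg (by omega)] at hup
    rw [h0] at hlow hupα hr
    rw [min_eq_left (by omega)] at hlow
    omega
  rw [if_pos (show 1 ≤ (r : ℕ) from h0)] at hup
  have hEG : (r + 1 : ℕ) * (r + 1 - 1) + (n - (r + 1)) * min (r + 1 : ℕ) b ≤ (r + 1) * α u + 1 := by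
    rw [Nat.add_sub_cancel]
    omega
  by_cases hs : 4 ≤ α u + b ∨ 3 ≤ (r + 1 : ℕ)
  · exact bound_arith hb (hbα u) hn h (by omega) r.isLt hs hEG
  -- the remaining small cases are excluded by parity
  push Not at hs
  have hbu := hbα u
  have hr1 : (r : ℕ) = 1 := by omega
  have hb1 : b = 1 := by omega
  have hmin : ∑ k ∈ Finset.Ioi r, min (r + 1 : ℕ) (β k) = ∑ k ∈ Finset.Ioi r, β k := by
    refine Finset.sum_congr rfl fun k hk => min_eq_right ?_
    have hk := Fin.lt_def.1 (Finset.mem_Ioi.1 hk)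
    have := hαu k
    simp only [hβ, Fin.ext_iff, hu, hv]
    rw [if_neg (by omega), if_neg (by omega)]
    omega
  -- An even total forces a violation by at least two; without parity, $a = 2$, $n = 5$ would
  -- survive.
  rw [← SimpleGraph.sum_Iic_add_sum_Ioi r] at heven'
  obtain ⟨c, hc⟩ := heven'
  rw [hmin] at hlow hr
  rw [hr1] at hlow hupα hr
  subst hb1
  norm_num at hlow hr h
  obtain h1 | h1 : α u = 1 ∨ α u = 2 := by omega
  · rw [h1] at hupα h
    omega
  · rw [h1] at hupα h
    omega

theorem mainTheorem8 (n : ℕ) (hn : 3 ≤ n) (α : Fin n → ℕ) (hα : IsGraphic α)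
    (hpos : 0 < α ⟨n - 1, by omega⟩)
    (hbound : (n : ℝ) ≥
      min ((((α ⟨0, by omega⟩ : ℕ) : ℝ) + ((α ⟨n - 1, by omega⟩ : ℕ) : ℝ) + 2) ^ 2 /
            (4 * ((α ⟨n - 1, by omega⟩ : ℕ) : ℝ)))
          ((((α ⟨0, by omega⟩ : ℕ) : ℝ) + ((α ⟨n - 1, by omega⟩ : ℕ) : ℝ)) ^ 2 /
            (2 * ((α ⟨n - 1, by omega⟩ : ℕ) : ℝ)))) :
    forcedSet α = ∅ := by
  obtain ⟨⟨hanti, -⟩, G₀, hG₀⟩ := hα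
  have hreal : ∀ G : SimpleGraph (Fin n), IsRealization α G ↔ ∀ i, G.ndegree i = α i := by
    intro G
    refine forall_congr' fun i => ?_
    rw [G.degree_eq_ndegree]
  have hu : ∀ i, α i ≤ α ⟨0, by omega⟩ := fun i => hanti (Fin.le_def.2 (Nat.zero_le _))
  have hv : ∀ i, i ≠ (⟨0, by omega⟩ : Fin n) → α i ≤ α ⟨1, by omega⟩ := fun i hi =>
    hanti (Fin.le_def.2 (Nat.one_le_iff_ne_zero.2 fun h => hi (Fin.ext h)))
  have heven : Even (∑ i, α i) := by
    rw [← Finset.sum_congr rfl fun i _ => (hreal G₀).1 hG₀ i]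
    exact G₀.even_sum_ndegree
  obtain ⟨H, hH⟩ := exists_realization_raised hanti heven (u := ⟨0, by omega⟩)
    (v := ⟨1, by omega⟩) rfl rfl hpos (fun i => hanti (Fin.le_def.2 (by simp; omega))) hn
    (nat_bound_of_real_bound hpos hbound)
  have h01 : (⟨0, by omega⟩ : Fin n) ≠ ⟨1, by omega⟩ := by simp
  have hnot : ¬ ∀ G : SimpleGraph (Fin n), (∀ i, G.ndegree i = α i) →
      G.Adj ⟨0, by omega⟩ ⟨1, by omega⟩ := fun h => not_realizable_of_forced h01 hv h H hH
  refine Set.eq_empty_of_forall_notMem fun e => ?_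
  induction e with
  | h x y =>
    rintro ⟨hxy, hall⟩
    rw [Sym2.mk_isDiag_iff] at hxy
    have hforced : ∀ G : SimpleGraph (Fin n), (∀ i, G.ndegree i = α i) → G.Adj x y :=
      fun G hG => hall G ((hreal G).2 hG)
    -- move one end to the first vertex, then the other one to the second
    have hfirst : ∃ w, w ≠ (⟨0, by omega⟩ : Fin n) ∧
        ∀ G : SimpleGraph (Fin n), (∀ i, G.ndegree i = α i) → G.Adj w ⟨0, by omega⟩ := by
      by_cases hy : y = ⟨0, by omega⟩
      · subst hy
        exact ⟨x, hxy, hforced⟩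
      · exact ⟨y, hy, fun G hG =>
          (forced_of_forced_of_le (Ne.symm hy) (hu x) hforced G hG).symm⟩
    obtain ⟨w, hw, hforced'⟩ := hfirst
    exact hnot fun G hG => (forced_of_forced_of_le h01.symm (hv w hw) hforced' G hG).symm
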